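/- A frame is a complete lattice in which $a \wedge \bigvee S = \bigvee\{a \wedge s \mid s \in S\}$ for every element $a$ and every subset $S$; it is compact if every subset $S$ with $\bigvee S = \top$ has a finite subset $S' \subseteq S$ with $\bigvee S' = \top$. For a frame $F$, the monotone neighbourhood frame $\mathsf{M}F$ is the frame presented by the generators $\Box a$ and $\Diamond a$, where $a$ ranges over $F$, subject to the relations \begin{enumerate} \item $\Box(a \wedge b) \leq \Box a$, \item $\Box a \wedge \Diamond b = \bot$ whenever $a \wedge b = \bot$, \item $\Box \bigvee A = \bigvee\{\Box a \mid a \in A\}$, \item $\Diamond a \leq \Diamond(a \vee b)$, \item $\Box a \vee \Diamond b = \top$ whenever $a \vee b = \top$, \item $\Diamond \bigvee A = \bigvee\{\Diamond a \mid a \in A\}$, \end{enumerate} for all $a, b \in F$ and all (nonempty) directed subsets $A \subseteq F$. \textbf{Theorem.} If $F$ is a compact frame, then $\mathsf{M}F$ is a compact frame. -/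

import Mathlib

universe u v

/-! ## Frame presentations -/

/-- The free frame on a set `G` of generators: the lower sets of the free meet-semilattice
on `G`, i.e. of the finite subsets of `G` under reverse inclusion.  A finite subset stands for
the meet of its elements and a lower set for the join of its members, so the elements are the
expressions in the generators built from finite meets and arbitrary joins, up to the equations
that hold in all frames. -/
abbrev FreeFrame (G : Type u) : Type u := LowerSet (Finset G)ᵒᵈ

namespace FreeFrame

/-- The generator `g` as an element of the free frame. -/
def gen {G : Type u} (g : G) : FreeFrame G := LowerSet.Iic (OrderDual.toDual {g})

theorem toDual_mem_finsetInf_gen {G : Type u} (s t : Finset G) :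
    OrderDual.toDual t ∈ s.inf gen ↔ s ⊆ t := by
  classical
  induction s using Finset.induction_on with
  | empty => simp
  | insert a s _ ih =>
    rw [Finset.inf_insert, LowerSet.mem_inf_iff, ih, Finset.insert_subset_iff]
    simp [gen]

theorem finsetInf_gen {G : Type u} (s : Finset G) :
    s.inf gen = LowerSet.Iic (OrderDual.toDual s) := by
  ext t
  exact toDual_mem_finsetInf_gen s (OrderDual.ofDual t)

/-- Every element is a join of finite meets of generators. -/
theorem eq_iSup {G : Type u} (U : FreeFrame G) :
    U = ⨆ (s : Finset G) (_ : OrderDual.toDual s ∈ U), s.inf gen := by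
  ext t
  simp only [LowerSet.coe_iSup, Set.mem_iUnion, SetLike.mem_coe, finsetInf_gen]
  constructor
  · intro h
    exact ⟨OrderDual.ofDual t, h, LowerSet.mem_Iic_iff.2 le_rfl⟩
  · rintro ⟨s, hs, hts⟩
    exact U.lower hts hs

/-- The value in a frame of an expression, given values of the generators. -/
def lift {G : Type u} {L : Type v} [Order.Frame L] (f : G → L) : FrameHom (FreeFrame G) L where
  toFun U := ⨆ (s : Finset G) (_ : OrderDual.toDual s ∈ U), s.inf f
  map_inf' U V := by
    classical
    apply le_antisymm
    · refine iSup₂_le fun s hs => le_inf ?_ ?_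
      · exact le_iSup₂_of_le s hs.1 le_rfl
      · exact le_iSup₂_of_le s hs.2 le_rfl
    · simp only [iSup_inf_eq, inf_iSup_eq]
      refine iSup₂_le fun t ht => iSup₂_le fun s hs => ?_
      refine le_iSup₂_of_le (s ∪ t) ⟨?_, ?_⟩ ?_
      · exact U.lower (OrderDual.toDual_le_toDual.2 Finset.subset_union_left) hs
      · exact V.lower (OrderDual.toDual_le_toDual.2 Finset.subset_union_right) ht
      · rw [Finset.inf_union]
  map_top' := by
    refine top_le_iff.1 (le_iSup₂_of_le ∅ trivial ?_)
    simp
  map_sSup' S := by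
    apply le_antisymm
    · refine iSup₂_le fun s hs => ?_
      obtain ⟨U, hU, hsU⟩ := LowerSet.mem_sSup_iff.1 hs
      refine le_trans ?_ (le_sSup (Set.mem_image_of_mem _ hU))
      exact le_iSup₂_of_le s hsU le_rfl
    · refine sSup_le ?_
      rintro _ ⟨U, hU, rfl⟩
      refine iSup₂_le fun s hs => le_iSup₂_of_le s ?_ le_rfl
      exact LowerSet.mem_sSup_iff.2 ⟨U, hU, hs⟩

theorem lift_gen {G : Type u} {L : Type v} [Order.Frame L] (f : G → L) (g : G) :
    lift f (gen g) = f g := by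
  apply le_antisymm
  · refine iSup₂_le fun s hs => ?_
    have hs' : {g} ⊆ s := hs
    exact Finset.inf_le (Finset.singleton_subset_iff.1 hs')
  · refine le_iSup₂_of_le (f := fun (s : Finset G) (_ : OrderDual.toDual s ∈ gen g) => s.inf f)
      {g} (LowerSet.mem_Iic_iff.2 le_rfl) ?_
    simp

/-- A frame homomorphism out of the free frame is determined by its values on generators. -/
theorem eq_lift {G : Type u} {L : Type v} [Order.Frame L] (h : FrameHom (FreeFrame G) L) :
    h = lift fun g => h (gen g) := by
  ext U
  conv_lhs => rw [eq_iSup U]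
  rw [map_iSup₂]
  simp only [map_finset_inf]
  rfl

end FreeFrame

/-- The sublocale of the free frame cut out by a family `R` of relations `x = y`: it consists of
the `U` that do not distinguish `x` from `y`, for every relation `x = y` of `R`. -/
def relationSublocale {G : Type u} (R : FreeFrame G → FreeFrame G → Prop) :
    Sublocale (FreeFrame G) where
  carrier := {U | ∀ x y, R x y → x ⇨ U = y ⇨ U}
  sInf_mem' S hS x y hxy := by
    refine eq_of_forall_le_iff fun z => ?_
    simp only [le_himp_iff, le_sInf_iff]
    refine forall₂_congr fun U hU => ?_
    rw [← le_himp_iff, ← le_himp_iff, hS hU x y hxy]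
  himp_mem' a U hU x y hxy := by
    rw [himp_left_comm x, himp_left_comm y, hU x y hxy]

/-- The frame presented by the generators `G` and the relations `x = y` for `R x y`.
It is characterised up to isomorphism by `PresentedFrame.lift_gen_eq_of_rel`,
`PresentedFrame.exists_eq_sSup` and `PresentedFrame.existsUnique_lift`. -/
def PresentedFrame {G : Type u} (R : FreeFrame G → FreeFrame G → Prop) : Type u :=
  relationSublocale R

namespace PresentedFrame

instance {G : Type u} (R : FreeFrame G → FreeFrame G → Prop) : Order.Frame (PresentedFrame R) :=
  inferInstanceAs (Order.Frame (relationSublocale R))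

/-- The quotient map from the free frame: the value of an expression in the presented frame. -/
def mk {G : Type u} (R : FreeFrame G → FreeFrame G → Prop) :
    FrameHom (FreeFrame G) (PresentedFrame R) :=
  (relationSublocale R).restrict

/-- The image of a generator. -/
def gen {G : Type u} (R : FreeFrame G → FreeFrame G → Prop) (g : G) : PresentedFrame R :=
  mk R (FreeFrame.gen g)

theorem mk_le_iff {G : Type u} (R : FreeFrame G → FreeFrame G → Prop) (x : FreeFrame G)
    (U : relationSublocale R) : mk R x ≤ (U : PresentedFrame R) ↔ x ≤ (U : FreeFrame G) :=
  (relationSublocale R).giRestrict.gc x U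

/-- The relations hold in the presented frame. -/
theorem mk_eq_of_rel {G : Type u} {R : FreeFrame G → FreeFrame G → Prop} {x y : FreeFrame G}
    (h : R x y) : mk R x = mk R y := by
  refine eq_of_forall_ge_iff fun (U : relationSublocale R) => ?_
  have hU : x ⇨ (U : FreeFrame G) = y ⇨ (U : FreeFrame G) := U.2 x y h
  rw [mk_le_iff R x U, mk_le_iff R y U, ← himp_eq_top_iff, hU, himp_eq_top_iff]

/-- The evaluation of expressions at the generators is the quotient map. -/
theorem lift_gen {G : Type u} (R : FreeFrame G → FreeFrame G → Prop) :
    FreeFrame.lift (gen R) = mk R :=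
  (FreeFrame.eq_lift (mk R)).symm

/-- The relations hold for the generators of the presented frame. -/
theorem lift_gen_eq_of_rel {G : Type u} {R : FreeFrame G → FreeFrame G → Prop}
    {x y : FreeFrame G} (h : R x y) :
    FreeFrame.lift (gen R) x = FreeFrame.lift (gen R) y := by
  rw [lift_gen, mk_eq_of_rel h]

theorem mk_surjective {G : Type u} (R : FreeFrame G → FreeFrame G → Prop) :
    Function.Surjective (mk R) :=
  (relationSublocale R).giRestrict.l_surjective

/-- The generators generate: every element is a join of finite meets of generators. -/
theorem exists_eq_sSup {G : Type u} (R : FreeFrame G → FreeFrame G → Prop)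
    (a : PresentedFrame R) :
    ∃ S : Set (Finset G), a = sSup ((fun s : Finset G => s.inf (gen R)) '' S) := by
  obtain ⟨U, rfl⟩ := mk_surjective R a
  refine ⟨{s | OrderDual.toDual s ∈ U}, ?_⟩
  rw [← lift_gen, sSup_image]
  rfl

/-- The universal property: an assignment of the generators that satisfies the relations extends
uniquely to a frame homomorphism. -/
theorem existsUnique_lift {G : Type u} (R : FreeFrame G → FreeFrame G → Prop) {L : Type v}
    [Order.Frame L] (f : G → L)
    (hf : ∀ x y, R x y → FreeFrame.lift f x = FreeFrame.lift f y) :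
    ∃! h : FrameHom (PresentedFrame R) L, ∀ g, h (gen R g) = f g := by
  have gc : GaloisConnection (FreeFrame.lift f)
      (fun v : L => sSup {U | FreeFrame.lift f U ≤ v}) := by
    intro U v
    constructor
    · intro h
      exact le_sSup h
    · intro h
      refine le_trans (OrderHomClass.mono (FreeFrame.lift f) h) ?_
      rw [map_sSup]
      refine sSup_le ?_
      rintro _ ⟨V, hV, rfl⟩
      exact hV
  have sat : ∀ v : L, sSup {U | FreeFrame.lift f U ≤ v} ∈ relationSublocale R := by
    intro v x y hxy
    refine eq_of_forall_le_iff fun z => ?_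
    rw [le_himp_iff, le_himp_iff, ← gc, ← gc, map_inf, map_inf, hf x y hxy]
  have key : ∀ U : FreeFrame G,
      FreeFrame.lift f (mk R U : relationSublocale R).1 = FreeFrame.lift f U := by
    intro U
    apply le_antisymm
    · rw [gc]
      have : mk R U ≤ (⟨_, sat (FreeFrame.lift f U)⟩ : relationSublocale R) := by
        rw [mk_le_iff]
        exact (gc _ _).1 le_rfl
      exact this
    · exact OrderHomClass.mono (FreeFrame.lift f) ((mk_le_iff R U _).1 le_rfl)
  let h : FrameHom (PresentedFrame R) L :=
    { toFun := fun a => FreeFrame.lift f (show relationSublocale R from a).1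
      map_inf' := fun a b => map_inf (FreeFrame.lift f) _ _
      map_top' := map_top (FreeFrame.lift f)
      map_sSup' := fun S => by
        obtain ⟨T, rfl⟩ := (mk_surjective R).image_surjective S
        rw [← map_sSup (mk R) T, ← Set.image_comp]
        refine (key _).trans ?_
        rw [map_sSup]
        congr 1
        exact Set.image_congr fun U _ => (key U).symm }
  refine ⟨h, fun g => (key _).trans (FreeFrame.lift_gen f g), fun h' hh' => ?_⟩
  have e : ∀ U, h' (mk R U) = h (mk R U) := by
    intro U
    have e1 := FreeFrame.eq_lift (h'.comp (mk R))
    have e2 : (fun g => (h'.comp (mk R)) (FreeFrame.gen g)) = f := funext hh'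
    rw [e2] at e1
    exact (DFunLike.congr_fun e1 U).trans (key U).symm
  ext a
  obtain ⟨U, rfl⟩ := mk_surjective R a
  exact e U

end PresentedFrame

/-! ## The monotone neighbourhood frame -/

/-- The generators `□ a` and `◇ a`, where `a` ranges over `F`. -/
inductive MonotoneGen (F : Type u) : Type u where
  | box (a : F) : MonotoneGen F
  | dia (a : F) : MonotoneGen F

namespace MonotoneGen

/-- `□ a` as an element of the free frame. -/
def fbox {F : Type u} (a : F) : FreeFrame (MonotoneGen F) := FreeFrame.gen (box a)

/-- `◇ a` as an element of the free frame. -/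
def fdia {F : Type u} (a : F) : FreeFrame (MonotoneGen F) := FreeFrame.gen (dia a)

end MonotoneGen

open MonotoneGen in
/-- The defining relations `x = y` of the monotone neighbourhood frame; an inequality `x ≤ y` is
written as the equation `x ⊔ y = y`.  Directed sets are nonempty. -/
inductive MonotoneRel (F : Type u) [Order.Frame F] :
    FreeFrame (MonotoneGen F) → FreeFrame (MonotoneGen F) → Prop where
  | box_mono (a b : F) : MonotoneRel F (fbox (a ⊓ b) ⊔ fbox a) (fbox a)
  | box_inf_dia (a b : F) (h : a ⊓ b = ⊥) : MonotoneRel F (fbox a ⊓ fdia b) ⊥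
  | box_sSup (A : Set F) (hne : A.Nonempty) (hA : DirectedOn (· ≤ ·) A) :
      MonotoneRel F (fbox (sSup A)) (⨆ a ∈ A, fbox a)
  | dia_mono (a b : F) : MonotoneRel F (fdia a ⊔ fdia (a ⊔ b)) (fdia (a ⊔ b))
  | box_sup_dia (a b : F) (h : a ⊔ b = ⊤) : MonotoneRel F (fbox a ⊔ fdia b) ⊤
  | dia_sSup (A : Set F) (hne : A.Nonempty) (hA : DirectedOn (· ≤ ·) A) :
      MonotoneRel F (fdia (sSup A)) (⨆ a ∈ A, fdia a)

/-- The monotone neighbourhood frame of `F`. -/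
abbrev MonotoneNbhdFrame (F : Type u) [Order.Frame F] : Type u :=
  PresentedFrame (MonotoneRel F)

/-! ## Compact frames -/

/-- A frame is compact if every set with join `⊤` has a finite subset with join `⊤`. -/
def IsCompactFrame (F : Type u) [Order.Frame F] : Prop :=
  ∀ S : Set F, sSup S = ⊤ → ∃ T : Set F, T ⊆ S ∧ T.Finite ∧ sSup T = ⊤

/-! If a cover of `⊤` had no finite subcover, some prime ideal `I` of the neighbourhood frame would
contain it. A point (a homomorphism to `Prop`) that is false on `I` then gives a contradiction,
since it preserves the join `⊤`. The sets of `a` with `box a ∉ I`, respectively `dia a ∉ I`, satisfy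
the two relations linking `□` and `◇`, but need not be Scott open. They are shrunk to `D := cocover
{a | box a ∉ I}` and `cocover D`. Compactness of `F` makes these Scott open
(`sSup_mem_cocover_iff`), shrinking preserves the disjointness relation, and the covering relation
holds by construction. `exists_point` turns the pair into a point, and `notMem_of_point` shows that
it avoids `I`. -/

/-- In a compact frame, the elements that together with `b` cover `⊤` are inaccessible by
directed joins. -/
theorem IsCompactFrame.exists_sup_eq_top {F : Type u} [Order.Frame F] (hF : IsCompactFrame F)
    {A : Set F} (hne : A.Nonempty) (hA : DirectedOn (· ≤ ·) A) {b : F} (h : sSup A ⊔ b = ⊤) :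
    ∃ a ∈ A, a ⊔ b = ⊤ := by
  obtain ⟨T, hTS, hTfin, hT⟩ := hF (insert b A) (by rw [sSup_insert, sup_comm, h])
  -- Directedness merges the members of `A` in `T` into a single `a`; nonemptiness of `A` supplies
  -- `a` when there are none.
  have key : ∀ T : Set F, T.Finite → T ⊆ insert b A → ∃ a ∈ A, sSup T ≤ a ⊔ b := by
    intro T hfin
    induction T, hfin using Set.Finite.induction_on with
    | empty => exact fun _ => ⟨hne.some, hne.some_mem, by simp⟩
    | @insert t T _ _ ih =>
      intro hsub
      obtain ⟨ht, hsub⟩ := Set.insert_subset_iff.1 hsub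
      obtain ⟨a, ha, hle⟩ := ih hsub
      rcases ht with rfl | ht
      · exact ⟨a, ha, by rw [sSup_insert]; exact sup_le le_sup_right hle⟩
      · obtain ⟨c, hc, htc, hac⟩ := hA t ht a ha
        refine ⟨c, hc, ?_⟩
        rw [sSup_insert]
        exact sup_le (htc.trans le_sup_left) (hle.trans (sup_le_sup_right hac b))
  obtain ⟨a, ha, hle⟩ := key T hTfin hTS
  exact ⟨a, ha, top_le_iff.1 (hT ▸ hle)⟩

/-! ### Scott open sets from covers -/

/-- The elements that together with some element outside of `X` cover `⊤`. -/
def cocover {F : Type u} [Order.Frame F] (X : Set F) : Set F := {a | ∃ b, b ∉ X ∧ a ⊔ b = ⊤}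

section Cocover

variable {F : Type u} [Order.Frame F] {X Y : Set F}

theorem isUpperSet_cocover : IsUpperSet (cocover X) := by
  rintro a b hab ⟨c, hc, h⟩
  exact ⟨c, hc, top_le_iff.1 (h ▸ sup_le_sup_right hab c)⟩

theorem sSup_mem_cocover_iff (hF : IsCompactFrame F) {A : Set F} (hne : A.Nonempty)
    (hA : DirectedOn (· ≤ ·) A) : sSup A ∈ cocover X ↔ ∃ a ∈ A, a ∈ cocover X := by
  constructor
  · rintro ⟨b, hb, h⟩
    obtain ⟨a, ha, hab⟩ := hF.exists_sup_eq_top hne hA h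
    exact ⟨a, ha, b, hb, hab⟩
  · rintro ⟨a, ha, h⟩
    exact isUpperSet_cocover (le_sSup ha) h

/-- Since `b ∉ Y`, only the first alternative remains. Hence `cocover Y` is the least set that
satisfies the covering condition with `Y`. -/
theorem cocover_subset (h : ∀ a b, a ⊔ b = ⊤ → a ∈ X ∨ b ∈ Y) : cocover Y ⊆ X := by
  rintro a ⟨b, hb, hab⟩
  exact (h a b hab).resolve_right hb

end Cocover

/-! ### Points and prime ideals -/

namespace MonotoneNbhdFrame

variable {F : Type u} [Order.Frame F]

/-- The generator `□ a`. -/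
def box (a : F) : MonotoneNbhdFrame F := PresentedFrame.gen _ (MonotoneGen.box a)

/-- The generator `◇ a`. -/
def dia (a : F) : MonotoneNbhdFrame F := PresentedFrame.gen _ (MonotoneGen.dia a)

theorem box_inf_dia {a b : F} (h : a ⊓ b = ⊥) : box a ⊓ dia b = ⊥ := by
  have := PresentedFrame.mk_eq_of_rel (MonotoneRel.box_inf_dia a b h)
  rwa [map_inf, map_bot] at this

theorem box_sup_dia {a b : F} (h : a ⊔ b = ⊤) : box a ⊔ dia b = ⊤ := by
  have := PresentedFrame.mk_eq_of_rel (MonotoneRel.box_sup_dia a b h)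
  rwa [map_sup, map_top] at this

/-- A pair of Scott open sets that is compatible with the relations between `□` and `◇` is
a point of the monotone neighbourhood frame. -/
theorem exists_point (N D : Set F) (hN : IsUpperSet N) (hD : IsUpperSet D)
    (hN' : ∀ A : Set F, A.Nonempty → DirectedOn (· ≤ ·) A → (sSup A ∈ N ↔ ∃ a ∈ A, a ∈ N))
    (hD' : ∀ A : Set F, A.Nonempty → DirectedOn (· ≤ ·) A → (sSup A ∈ D ↔ ∃ a ∈ A, a ∈ D))
    (hinf : ∀ a b, a ⊓ b = ⊥ → ¬(a ∈ N ∧ b ∈ D))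
    (hsup : ∀ a b, a ⊔ b = ⊤ → a ∈ N ∨ b ∈ D) :
    ∃ h : FrameHom (MonotoneNbhdFrame F) Prop,
      (∀ a, h (box a) ↔ a ∈ N) ∧ ∀ a, h (dia a) ↔ a ∈ D := by
  obtain ⟨h, hh, -⟩ := PresentedFrame.existsUnique_lift (MonotoneRel F) (L := Prop)
    (fun g => MonotoneGen.rec (fun a => a ∈ N) (fun a => a ∈ D) g) (by
      rintro _ _ (⟨a, b⟩ | ⟨a, b, h⟩ | ⟨A, hne, hA⟩ | ⟨a, b⟩ | ⟨a, b, h⟩ | ⟨A, hne, hA⟩) <;>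
        simp only [MonotoneGen.fbox, MonotoneGen.fdia, map_sup, map_inf, map_bot, map_top,
          map_iSup, FreeFrame.lift_gen]
      · exact sup_eq_right.2 (hN inf_le_left)
      · exact eq_false (hinf a b h)
      · simpa using hN' A hne hA
      · exact sup_eq_right.2 (hD le_sup_left)
      · exact eq_true (hsup a b h)
      · simpa using hD' A hne hA)
  exact ⟨h, fun a => (hh (.box a)).to_iff, fun a => (hh (.dia a)).to_iff⟩

/-- A point whose generators lie outside of a prime ideal lies outside of it. -/
theorem notMem_of_point {I : Order.Ideal (MonotoneNbhdFrame F)} (hI : I.IsPrime)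
    {h : FrameHom (MonotoneNbhdFrame F) Prop} (hbox : ∀ a, h (box a) → box a ∉ I)
    (hdia : ∀ a, h (dia a) → dia a ∉ I) {x : MonotoneNbhdFrame F} (hx : h x) : x ∉ I := by
  classical
  obtain ⟨S, rfl⟩ := PresentedFrame.exists_eq_sSup (MonotoneRel F) x
  rw [map_sSup] at hx
  -- A join in `Prop` is an existential, so the point holds at one finite meet of generators below
  -- `x`.
  obtain ⟨_, ⟨_, ⟨s, hs, rfl⟩, rfl⟩, hx⟩ := (sSup_Prop_eq ▸ hx : ∃ p ∈ _, p)
  intro hmem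
  replace hmem := I.lower (le_sSup (Set.mem_image_of_mem _ hs)) hmem
  beta_reduce at hx hmem
  clear hs
  induction s using Finset.induction_on with
  | empty => exact hI.top_notMem hmem
  | insert g s _ ih =>
    rw [Finset.inf_insert] at hx hmem
    rw [map_inf] at hx
    rcases hI.mem_or_mem hmem with hg | hs
    · cases g with
      | box a => exact hbox a hx.1 hg
      | dia a => exact hdia a hx.1 hg
    · exact ih hx.2 hs

/-- If `F` is compact, then every prime ideal of the monotone neighbourhood frame is avoided by
some point. -/
theorem exists_point_of_isPrime (hF : IsCompactFrame F)
    {I : Order.Ideal (MonotoneNbhdFrame F)} (hI : I.IsPrime) :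
    ∃ h : FrameHom (MonotoneNbhdFrame F) Prop, ∀ x ∈ I, ¬h x := by
  have hcover : ∀ a b : F, a ⊔ b = ⊤ → a ∈ {a | box a ∉ I} ∨ b ∈ {b | dia b ∉ I} := by
    intro a b hab
    by_contra! hc
    simp only [Set.mem_ofPred_eq, not_not] at hc
    exact hI.top_notMem (box_sup_dia hab ▸ Order.Ideal.sup_mem hc.1 hc.2)
  set D : Set F := cocover {a | box a ∉ I}
  have hDI : D ⊆ {b | dia b ∉ I} :=
    cocover_subset fun a b hab => (hcover b a (sup_comm a b ▸ hab)).symm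
  have hNI : cocover D ⊆ {a | box a ∉ I} :=
    cocover_subset fun a b hab => or_iff_not_imp_left.2 fun ha => ⟨a, ha, sup_comm a b ▸ hab⟩
  obtain ⟨h, hbox, hdia⟩ := exists_point (cocover D) D isUpperSet_cocover isUpperSet_cocover
    (fun A => sSup_mem_cocover_iff hF) (fun A => sSup_mem_cocover_iff hF)
    (fun a b hab hmem => by
      have : box a ⊓ dia b ∈ I := box_inf_dia hab ▸ I.bot_mem
      exact (hI.mem_or_mem this).elim (hNI hmem.1) (hDI hmem.2))
    -- If `b ∉ D`, then `b` itself witnesses `a ∈ cocover D`.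
    (fun a b hab => or_iff_not_imp_right.2 fun hb => ⟨b, hb, hab⟩)
  exact ⟨h, fun x hx hhx => notMem_of_point hI (fun a ha => hNI ((hbox a).1 ha))
    (fun a ha => hDI ((hdia a).1 ha)) hhx hx⟩

end MonotoneNbhdFrame

/-! ### Compactness from points -/

/-- The ideal of the elements that are covered by finitely many elements of `S`. -/
def finiteCoverIdeal {L : Type u} [CompleteLattice L] (S : Set L) : Order.Ideal L where
  carrier := {x | ∃ T ⊆ S, T.Finite ∧ x ≤ sSup T}
  lower' := fun _ _ hyx ⟨T, hT, hfin, hx⟩ => ⟨T, hT, hfin, hyx.trans hx⟩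
  nonempty' := ⟨⊥, ∅, Set.empty_subset S, Set.finite_empty, bot_le⟩
  directed' := fun x ⟨T, hT, hfin, hx⟩ y ⟨T', hT', hfin', hy⟩ =>
    ⟨x ⊔ y, ⟨T ∪ T', Set.union_subset hT hT', hfin.union hfin', by
      rw [sSup_union]; exact sup_le_sup hx hy⟩, le_sup_left, le_sup_right⟩

/-- A frame in which every prime ideal is avoided by some point is compact. -/
theorem isCompactFrame_of_exists_point {L : Type u} [Order.Frame L]
    (hL : ∀ I : Order.Ideal L, I.IsPrime → ∃ h : FrameHom L Prop, ∀ x ∈ I, ¬h x) :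
    IsCompactFrame L := by
  intro S hS
  by_contra hfin
  -- The filter is `{⊤}`, so disjointness says that no finite part of `S` covers `⊤`.
  have hdisj : Disjoint (Order.PFilter.principal (⊤ : L) : Set L) (finiteCoverIdeal S) := by
    refine Set.disjoint_left.2 ?_
    rintro x hx ⟨T, hT, hTfin, hxT⟩
    exact hfin ⟨T, hT, hTfin, top_le_iff.1 ((Order.PFilter.mem_principal.1 hx).trans hxT)⟩
  obtain ⟨I, hI, hle, -⟩ := DistribLattice.prime_ideal_of_disjoint_filter_ideal hdisj
  obtain ⟨h, hh⟩ := hL I hI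
  have htop : h (sSup S) := by rw [hS, map_top]; trivial
  rw [map_sSup] at htop
  obtain ⟨_, ⟨s, hs, rfl⟩, hhs⟩ := (sSup_Prop_eq ▸ htop : ∃ p ∈ _, p)
  exact hh s (hle ⟨{s}, Set.singleton_subset_iff.2 hs, Set.finite_singleton s,
    sSup_singleton.ge⟩) hhs

theorem mainTheorem7 {F : Type u} [Order.Frame F] (hF : IsCompactFrame F) :
    IsCompactFrame (MonotoneNbhdFrame F) :=
  isCompactFrame_of_exists_point fun _ hI => MonotoneNbhdFrame.exists_point_of_isPrime hF hI
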